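/- Let $n$ be a positive integer with $n\equiv 1\pmod 4$, let $r\ge 1$ be an integer, and let $d\in\{1,2\}$. Let $(a;q)_m=\prod_{i=0}^{m-1}(1-aq^i)$ (so $(a;q)_0=1$), let $[n]=(1-q^n)/(1-q)$, and let $\Phi_m(q)$ be the $m$-th cyclotomic polynomial. For rational functions $A(q),B(q)\in\mathbb{Q}(q)$ and a polynomial $P(q)\in\mathbb{Z}[q]$, write $A(q)\equiv B(q)\pmod{P(q)}$ if the numerator of $A(q)-B(q)$, written as a reduced fraction of polynomials in $\mathbb{Z}[q]$, is divisible by $P(q)$ in $\mathbb{Z}[q]$. Then, modulo $\Phi_{n^r}(q)\prod_{j=1}^{r}\Phi_{n^j}(q)$, $$ \sum_{k=0}^{(n^r-1)/d}\frac{(q;q^2)_k^2(q^2;q^4)_k}{(q^2;q^2)_k^2(q^4;q^4)_k}q^{2k} \equiv [n]\,\frac{(q^3;q^4)_{(n^r-1)/2}\,(q^{5n};q^{4n})_{(n^{r-1}-1)/2}}{(q^5;q^4)_{(n^r-1)/2}\,(q^{3n};q^{4n})_{(n^{r-1}-1)/2}} \sum_{k=0}^{(n^{r-1}-1)/d}\frac{(q^n;q^{2n})_k^2(q^{2n};q^{4n})_k}{(q^{2n};q^{2n})_k^2(q^{4n};q^{4n})_k}q^{2nk}.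 $$ -/

import Mathlib

open Polynomial

/-- The `q`-shifted factorial `(a; q)_n = (1 - a) (1 - a q) ⋯ (1 - a q ^ (n - 1))`, with
`(a; q)_0 = 1`. -/
def qPochhammer {K : Type*} [Field K] (a q : K) (n : ℕ) : K :=
  ∏ i ∈ Finset.range n, (1 - a * q ^ i)

/-- The `q`-integer `[n]_q = (1 - q ^ n) / (1 - q)` (used for `q ≠ 1` only). -/
def qInteger {K : Type*} [Field K] (n : ℕ) (q : K) : K :=
  (1 - q ^ n) / (1 - q)

/-- Congruence of two rational functions modulo a polynomial `P ∈ ℤ[q]`: the numerator of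
`A - B`, written as a reduced fraction of polynomials in `ℤ[q]`, is divisible by `P` in `ℤ[q]`.
Here `RatFunc ℤ` is the fraction field of `ℤ[q]`. -/
def RatFuncCongr (P : ℤ[X]) (A B : RatFunc ℤ) : Prop :=
  P ∣ IsFractionRing.num ℤ[X] (A - B)

/-- The indeterminate `q`, as a rational function. -/
noncomputable def qvar : RatFunc ℤ := RatFunc.X

/-! For n > 1 the modulus is a product of powers of distinct primes Φ_N of ℤ[q], N = n^j, so it
suffices to bound the Φ_N-adic valuation of the difference of the two sides for each j. In the
residue field q is a primitive N-th root of unity, and 1 - q^N is small. Terms satisfy a Lucas-type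
congruence term(q, Ns + t) ≈ term(q^N, s) · term(q, t) for t ≤ (N-1)/2, while the rest of each block
has order (1 - q^N)^3 (`mulClose_dworkTerm`, `val_dworkTerm_of_lt`). Hence the long sum is ≈ T(q, N)
· S, with T the half-period sum `dworkSum` and S a truncated sum in q^N. Since (q^n)^(N/n) = q^N,
the sum in q^n is ≈ T(q^n, N/n) · S with the same S.

Andrews' q-Watson sum (`sum_watsonTerm`) identifies T with the product P = `dworkProd` up to (1 -
q^N)^2 (`dworkSum_sub_dworkProd_le`). The prefactor of the theorem is P(q, n^r) / P(q^n, n^(r-1)),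
and P has a Lucas-type factorisation too (`mulClose_dworkProd_mul`), which reduces that quotient to
P(q, N) / P(q^n, N/n). For j = r there is only one block, so every error is of second order; this
accounts for the extra factor Φ_{n^r}. -/

section Watson

/-! ### The terminating q-Watson sum -/

variable {K : Type*} [Field K]

theorem qPochhammer_zero (a q : K) : qPochhammer a q 0 = 1 := by
  simp [qPochhammer]

theorem qPochhammer_succ (a q : K) (n : ℕ) :
    qPochhammer a q (n + 1) = qPochhammer a q n * (1 - a * q ^ n) := by
  simp [qPochhammer, Finset.prod_range_succ]

theorem qPochhammer_shift_two (a q : K) (n : ℕ) :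
    (1 - a) * (1 - a * q) * qPochhammer (a * q ^ 2) q n =
      qPochhammer a q n * (1 - a * q ^ n) * (1 - a * q ^ (n + 1)) := by
  induction n with
  | zero => simp [qPochhammer_zero]
  | succ n ih =>
    rw [qPochhammer_succ, qPochhammer_succ, ← mul_assoc, ih]
    ring

theorem qPochhammer_ne_zero {a q : K} {n : ℕ} (h : ∀ i < n, a * q ^ i ≠ 1) :
    qPochhammer a q n ≠ 0 := by
  rw [qPochhammer, Finset.prod_ne_zero_iff]
  intro i hi
  exact sub_ne_zero.mpr (h i (Finset.mem_range.mp hi)).symm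

/-- The coefficients `(q; q²)_k / ((q; q)_k² (q²; q²)_k)` of the terminating `q`-Watson sum. -/
def watsonCoeff (q : K) (k : ℕ) : K :=
  qPochhammer q (q ^ 2) k / (qPochhammer q q k ^ 2 * qPochhammer (q ^ 2) (q ^ 2) k)

/-- The summand of the terminating `q`-Watson sum, where `z` stands for `x⁻¹`. -/
def watsonTerm (q x z : K) (k : ℕ) : K :=
  qPochhammer z q k * qPochhammer (x * q) q k * watsonCoeff q k * q ^ k

theorem watsonCoeff_succ {q : K} (hq : ∀ i : ℕ, i ≠ 0 → q ^ i ≠ 1) (k : ℕ) :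
    watsonCoeff q (k + 1) * ((1 - q ^ (k + 1)) ^ 2 * (1 - q ^ (2 * (k + 1)))) =
      watsonCoeff q k * (1 - q ^ (2 * k + 1)) := by
  have h1 : qPochhammer q q k ≠ 0 :=
    qPochhammer_ne_zero fun i _ => by rw [← pow_succ']; exact hq _ (by omega)
  have h2 : qPochhammer (q ^ 2) (q ^ 2) k ≠ 0 :=
    qPochhammer_ne_zero fun i _ => by
      rw [← pow_succ', ← pow_mul]; exact hq _ (by omega)
  have h3 : 1 - q ^ (k + 1) ≠ 0 := sub_ne_zero.mpr (hq _ (by omega)).symm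
  have h4 : 1 - q ^ (2 * (k + 1)) ≠ 0 := sub_ne_zero.mpr (hq _ (by omega)).symm
  have e1 : 1 - q * q ^ k = 1 - q ^ (k + 1) := by ring
  have e2 : 1 - q ^ 2 * (q ^ 2) ^ k = 1 - q ^ (2 * (k + 1)) := by ring
  have e3 : 1 - q * (q ^ 2) ^ k = 1 - q ^ (2 * k + 1) := by ring
  simp only [watsonCoeff, qPochhammer_succ, e1, e2, e3]
  field_simp

/-- A contiguous relation in Gosper form: the combination of the sums at x q² and x telescopes. The
boundary term contains (z; q)_{k+1}, so it disappears once z is a suitable negative power of q,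
leaving a first-order recurrence in x. The prefactor (1 - xq)(1 - xq²) absorbs the shifts by q²
without division. -/
theorem watsonTerm_telescope {q x z : K} (hq : ∀ i : ℕ, i ≠ 0 → q ^ i ≠ 1)
    (hz : z * (x * q ^ 2) = 1) (k : ℕ) :
    (1 - x * q) * (1 - x * q ^ 2) *
        ((1 - x * q ^ 2) ^ 2 * ∑ i ∈ Finset.range (k + 1), watsonTerm q (x * q ^ 2) z i -
          q * (1 - x * q) ^ 2 * ∑ i ∈ Finset.range (k + 1), watsonTerm q x (z * q ^ 2) i) =
      -(q ^ 2 * x * (1 - x ^ 2 * q ^ 3)) *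
        (qPochhammer z q (k + 1) * qPochhammer (x * q) q (k + 1) *
          (watsonCoeff q k * (1 - q ^ (2 * k + 1)))) := by
  have hx : x ≠ 0 := by rintro rfl; simp at hz
  have hq0 : q ≠ 0 := by rintro rfl; simp at hz
  have hz' : z = (x * q ^ 2)⁻¹ := eq_inv_of_mul_eq_one_left hz
  induction k with
  | zero =>
    simp only [zero_add, Finset.range_one, Finset.sum_singleton, watsonTerm, watsonCoeff,
      qPochhammer_succ, qPochhammer_zero, hz']
    field_simp
    ring
  | succ k ih =>
    -- The increment from k to k + 1; `watsonCoeff_succ` expresses the old boundary term through the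
    -- coefficient at k + 1.
    have key : (1 - x * q) * (1 - x * q ^ 2) *
        ((1 - x * q ^ 2) ^ 2 * watsonTerm q (x * q ^ 2) z (k + 1) -
          q * (1 - x * q) ^ 2 * watsonTerm q x (z * q ^ 2) (k + 1)) =
      -(q ^ 2 * x * (1 - x ^ 2 * q ^ 3)) *
        (qPochhammer z q (k + 1 + 1) * qPochhammer (x * q) q (k + 1 + 1) *
          (watsonCoeff q (k + 1) * (1 - q ^ (2 * (k + 1) + 1))) -
        qPochhammer z q (k + 1) * qPochhammer (x * q) q (k + 1) *
          (watsonCoeff q (k + 1) * ((1 - q ^ (k + 1)) ^ 2 * (1 - q ^ (2 * (k + 1)))))) := by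
      have s1 := qPochhammer_shift_two (x * q) q (k + 1)
      have s2 := qPochhammer_shift_two z q (k + 1)
      have r1 : x * q ^ 2 * q = x * q * q ^ 2 := by ring
      have r2 : (1 - x * q) * (1 - x * q ^ 2) = q ^ 3 * x ^ 2 * ((1 - z) * (1 - z * q)) := by
        rw [hz']; field_simp; ring
      have t1 : (1 - x * q) * (1 - x * q ^ 2) * watsonTerm q (x * q ^ 2) z (k + 1) =
          qPochhammer z q (k + 1) * (qPochhammer (x * q) q (k + 1) *
            (1 - x * q * q ^ (k + 1)) * (1 - x * q * q ^ (k + 1 + 1))) *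
            watsonCoeff q (k + 1) * q ^ (k + 1) := by
        rw [← s1, watsonTerm, r1]; ring
      have t2 : (1 - x * q) * (1 - x * q ^ 2) * watsonTerm q x (z * q ^ 2) (k + 1) =
          q ^ 3 * x ^ 2 * (qPochhammer z q (k + 1) *
            (1 - z * q ^ (k + 1)) * (1 - z * q ^ (k + 1 + 1))) * qPochhammer (x * q) q (k + 1) *
            watsonCoeff q (k + 1) * q ^ (k + 1) := by
        rw [← s2, watsonTerm, r2]; ring
      have t3 : (1 - x * q) * (1 - x * q ^ 2) *
          ((1 - x * q ^ 2) ^ 2 * watsonTerm q (x * q ^ 2) z (k + 1) -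
            q * (1 - x * q) ^ 2 * watsonTerm q x (z * q ^ 2) (k + 1)) =
          (1 - x * q ^ 2) ^ 2 * ((1 - x * q) * (1 - x * q ^ 2) *
            watsonTerm q (x * q ^ 2) z (k + 1)) -
          q * (1 - x * q) ^ 2 * ((1 - x * q) * (1 - x * q ^ 2) *
            watsonTerm q x (z * q ^ 2) (k + 1)) := by ring
      rw [t3, t1, t2, qPochhammer_succ z q (k + 1), qPochhammer_succ (x * q) q (k + 1)]
      generalize qPochhammer z q (k + 1) = A
      generalize qPochhammer (x * q) q (k + 1) = B
      generalize watsonCoeff q (k + 1) = W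
      have p1 : q ^ (2 * (k + 1)) = (q ^ (k + 1)) ^ 2 := by ring
      have p2 : q ^ (2 * (k + 1) + 1) = (q ^ (k + 1)) ^ 2 * q := by ring
      rw [p1, p2, pow_succ q (k + 1)]
      generalize q ^ (k + 1) = y
      rw [hz']
      field_simp
      ring
    rw [Finset.sum_range_succ, Finset.sum_range_succ (watsonTerm q x (z * q ^ 2))]
    rw [watsonCoeff_succ hq] at key
    linear_combination ih + key

theorem qPochhammer_eq_zero {a q : K} {n i : ℕ} (hi : i < n) (h : a * q ^ i = 1) :
    qPochhammer a q n = 0 :=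
  Finset.prod_eq_zero (Finset.mem_range.mpr hi) (by rw [h, sub_self])

/-- Andrews' terminating `q`-analogue of Watson's sum, in the special case needed here. -/
theorem sum_watsonTerm {q : K} (hq0 : q ≠ 0) (hq : ∀ i : ℕ, i ≠ 0 → q ^ i ≠ 1) (h n : ℕ)
    (hn : 2 * h < n) :
    ∑ k ∈ Finset.range n, watsonTerm q (q ^ (2 * h)) (q ^ (2 * h))⁻¹ k =
      q ^ h * qPochhammer q (q ^ 2) h ^ 2 / qPochhammer (q ^ 2) (q ^ 2) h ^ 2 := by
  have hvanish : ∀ h k : ℕ, 2 * h < k → watsonTerm q (q ^ (2 * h)) (q ^ (2 * h))⁻¹ k = 0 := by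
    intro h k hk
    rw [watsonTerm, qPochhammer_eq_zero hk (inv_mul_cancel₀ (pow_ne_zero _ hq0))]
    simp
  -- The sums terminate at 2h, so h and h + 1 may share one cutoff, as the telescoping relation
  -- requires.
  have hext : ∀ h n : ℕ, 2 * h < n →
      ∑ k ∈ Finset.range n, watsonTerm q (q ^ (2 * h)) (q ^ (2 * h))⁻¹ k =
      ∑ k ∈ Finset.range (2 * h + 1), watsonTerm q (q ^ (2 * h)) (q ^ (2 * h))⁻¹ k := by
    intro h n hn
    symm
    apply Finset.sum_subset
    · intro i; simp only [Finset.mem_range]; omega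
    · intro i _ hi
      exact hvanish h i (by simp only [Finset.mem_range] at hi; omega)
  induction h generalizing n with
  | zero =>
    rw [hext 0 n hn]
    simp [watsonTerm, watsonCoeff, qPochhammer_zero]
  | succ h ih =>
    rw [hext (h + 1) n hn]
    have hz : (q ^ (2 * (h + 1)))⁻¹ * (q ^ (2 * h) * q ^ 2) = 1 := by
      rw [← pow_add]; exact inv_mul_cancel₀ (pow_ne_zero _ hq0)
    have T := watsonTerm_telescope hq hz (2 * (h + 1))
    have e1 : q ^ (2 * h) * q ^ 2 = q ^ (2 * (h + 1)) := by ring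
    have e2 : (q ^ (2 * (h + 1)))⁻¹ * q ^ 2 = (q ^ (2 * h))⁻¹ := by
      rw [← e1]; field_simp
    -- With z = q^(-2(h+1)) the last factor of (z; q)_{2h+3} is zero, so the boundary term vanishes.
    rw [qPochhammer_eq_zero (i := 2 * (h + 1)) (by omega)
      (inv_mul_cancel₀ (pow_ne_zero _ hq0)), e2, e1, ih _ (by omega), zero_mul, zero_mul,
      mul_zero] at T
    have n1 : 1 - q ^ (2 * h) * q ≠ 0 := by
      rw [← pow_succ]; exact sub_ne_zero.mpr (hq _ (by omega)).symm
    have n2 : 1 - q ^ (2 * (h + 1)) ≠ 0 := sub_ne_zero.mpr (hq _ (by omega)).symm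
    have n3 : qPochhammer (q ^ 2) (q ^ 2) h ≠ 0 :=
      qPochhammer_ne_zero fun i _ => by
        rw [← pow_succ', ← pow_mul]; exact hq _ (by omega)
    have T' := (mul_eq_zero.mp T).resolve_left (mul_ne_zero n1 n2)
    have e3 : 1 - q ^ 2 * (q ^ 2) ^ h = 1 - q ^ (2 * (h + 1)) := by ring
    have e4 : 1 - q * (q ^ 2) ^ h = 1 - q ^ (2 * h) * q := by ring
    rw [qPochhammer_succ, qPochhammer_succ, e3, e4]
    rw [sub_eq_zero, mul_comm, ← eq_div_iff (pow_ne_zero 2 n2)] at T'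
    rw [T']
    field_simp
    ring

end Watson

/-! ### Multiplicative approximation in a valued field -/

section OneUnit

variable {K Γ : Type*} [Field K] [LinearOrderedCommGroupWithZero Γ] {v : Valuation K Γ} {δ : Γ}

/-- `x` and `y` agree multiplicatively up to `δ`: `x / y ∈ 1 + {v ≤ δ}`. -/
def MulClose (v : Valuation K Γ) (δ : Γ) (x y : K) : Prop :=
  v (x / y - 1) ≤ δ

theorem MulClose.refl {x : K} (hx : x ≠ 0) : MulClose v δ x x := by
  simp [MulClose, hx]

/-- Ultrametric inequality. As division by zero yields 0, which is at distance 1 from 1, closeness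
with δ < 1 also forces both elements to be nonzero. -/
theorem MulClose.val_div (hδ : δ < 1) {x y : K} (h : MulClose v δ x y) : v (x / y) = 1 := by
  have h1 : v (x / y - 1) < v 1 := by rw [map_one]; exact h.trans_lt hδ
  have := v.map_add_eq_of_lt_left h1
  simpa using this

theorem MulClose.val_eq (hδ : δ < 1) {x y : K} (h : MulClose v δ x y) : v x = v y := by
  have h1 := h.val_div hδ
  rw [map_div₀] at h1
  exact (div_eq_one_iff_eq (by intro h0; simp [h0] at h1)).mp h1

theorem MulClose.right_ne_zero (hδ : δ < 1) {x y : K} (h : MulClose v δ x y) : y ≠ 0 := by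
  rintro rfl
  simpa using h.val_div hδ

theorem MulClose.left_ne_zero (hδ : δ < 1) {x y : K} (h : MulClose v δ x y) : x ≠ 0 := by
  rintro rfl
  simpa using h.val_div hδ

theorem MulClose.symm (hδ : δ < 1) {x y : K} (h : MulClose v δ x y) : MulClose v δ y x := by
  have hx := h.left_ne_zero hδ
  have hy := h.right_ne_zero hδ
  have e : y / x - 1 = -((x / y - 1) / (x / y)) := by field_simp; ring
  rw [MulClose, e, Valuation.map_neg, map_div₀, h.val_div hδ, div_one]
  exact h

theorem MulClose.mul (hδ : δ < 1) {x y x' y' : K} (h : MulClose v δ x y)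
    (h' : MulClose v δ x' y') : MulClose v δ (x * x') (y * y') := by
  have e : x * x' / (y * y') - 1 = (x / y - 1) * (x' / y') + (x' / y' - 1) := by
    rw [mul_div_mul_comm]; ring
  rw [MulClose, e]
  refine v.map_add_le ?_ h'
  rw [map_mul, h'.val_div hδ, mul_one]
  exact h

theorem MulClose.trans (hδ : δ < 1) {x y z : K} (h : MulClose v δ x y)
    (h' : MulClose v δ y z) : MulClose v δ x z := by
  have := h.mul hδ h'
  have hy := h.right_ne_zero hδ
  rwa [MulClose, mul_comm y z, mul_div_mul_right _ _ hy] at this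

theorem MulClose.inv (hδ : δ < 1) {x y : K} (h : MulClose v δ x y) :
    MulClose v δ x⁻¹ y⁻¹ := by
  have := h.symm hδ
  rwa [MulClose, inv_div_inv]

theorem MulClose.div (hδ : δ < 1) {x y x' y' : K} (h : MulClose v δ x y)
    (h' : MulClose v δ x' y') : MulClose v δ (x / x') (y / y') := by
  rw [div_eq_mul_inv, div_eq_mul_inv]
  exact h.mul hδ (h'.inv hδ)

theorem MulClose.pow (hδ : δ < 1) {x y : K} (h : MulClose v δ x y) (n : ℕ) :
    MulClose v δ (x ^ n) (y ^ n) := by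
  induction n with
  | zero => simpa using MulClose.refl one_ne_zero
  | succ n ih => rw [pow_succ, pow_succ]; exact ih.mul hδ h

theorem MulClose.prod (hδ : δ < 1) {ι : Type*} {s : Finset ι} {f g : ι → K}
    (h : ∀ i ∈ s, MulClose v δ (f i) (g i)) : MulClose v δ (∏ i ∈ s, f i) (∏ i ∈ s, g i) := by
  classical
  induction s using Finset.induction_on with
  | empty => simpa using MulClose.refl one_ne_zero
  | insert a s ha ih =>
    rw [Finset.prod_insert ha, Finset.prod_insert ha]
    exact (h a (Finset.mem_insert_self a s)).mul hδ
      (ih fun i hi => h i (Finset.mem_insert_of_mem hi))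

theorem MulClose.sub_le {x y : K} (hy0 : y ≠ 0) (h : MulClose v δ x y) (hy : v y ≤ 1) :
    v (x - y) ≤ δ := by
  have e : x - y = (x / y - 1) * y := by field_simp
  rw [e, map_mul]
  exact (mul_le_mul' h hy).trans (by rw [mul_one])

theorem MulClose.of_sub_le {x y : K} (hy : v y = 1) (h : v (x - y) ≤ δ) : MulClose v δ x y := by
  have hy0 : y ≠ 0 := by rintro rfl; simp at hy
  have e : x / y - 1 = (x - y) / y := by field_simp
  rw [MulClose, e, map_div₀, hy, div_one]
  exact h

end OneUnit

/-! ### Valuations at which q is a root of unity -/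

/-- `q` reduces to a primitive `L`-th root of unity in the residue field of `v`, which has
characteristic zero, while `q` itself is not a root of unity. -/
structure IsPrimitiveRootMod {K Γ : Type*} [Field K] [LinearOrderedCommGroupWithZero Γ]
    (v : Valuation K Γ) (q : K) (L : ℕ) : Prop where
  val_self : v q = 1
  val_lt : v (1 - q ^ L) < 1
  val_eq_one : ∀ i : ℕ, ¬ L ∣ i → v (1 - q ^ i) = 1
  pow_ne_one : ∀ i : ℕ, i ≠ 0 → q ^ i ≠ 1
  val_natCast : ∀ m : ℕ, m ≠ 0 → v (m : K) = 1

namespace IsPrimitiveRootMod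

variable {K Γ : Type*} [Field K] [LinearOrderedCommGroupWithZero Γ] {v : Valuation K Γ}
  {q : K} {L : ℕ}

theorem ne_zero (H : IsPrimitiveRootMod v q L) : q ≠ 0 := by
  rintro rfl
  simpa using H.val_self

theorem val_pow (H : IsPrimitiveRootMod v q L) (i : ℕ) : v (q ^ i) = 1 := by
  rw [map_pow, H.val_self, one_pow]

theorem one_sub_ne_zero (H : IsPrimitiveRootMod v q L) {i : ℕ} (hi : i ≠ 0) :
    1 - q ^ i ≠ 0 :=
  sub_ne_zero.mpr (H.pow_ne_one i hi).symm

/-- Allows every later estimate to be applied to q^n under the same valuation. -/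
theorem pow_root {n : ℕ} (H : IsPrimitiveRootMod v q (L * n)) (hn : n ≠ 0) :
    IsPrimitiveRootMod v (q ^ n) L where
  val_self := H.val_pow n
  val_lt := by rw [← pow_mul, mul_comm]; exact H.val_lt
  val_eq_one i hi := by
    rw [← pow_mul, mul_comm]
    exact H.val_eq_one _ fun h => hi (Nat.dvd_of_mul_dvd_mul_right (Nat.pos_of_ne_zero hn) h)
  pow_ne_one i hi := by rw [← pow_mul]; exact H.pow_ne_one _ (mul_ne_zero hn hi)
  val_natCast := H.val_natCast

/-- All multiples of `L` give the same valuation. -/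
theorem val_one_sub_pow_mul (H : IsPrimitiveRootMod v q L) {m : ℕ} (hm : m ≠ 0) :
    v (1 - q ^ (L * m)) = v (1 - q ^ L) := by
  have hsmall : ∀ j : ℕ, v (1 - (q ^ L) ^ j) < 1 := by
    intro j
    rw [← mul_neg_geom_sum, map_mul]
    refine (mul_le_of_le_one_right' ?_).trans_lt H.val_lt
    exact v.map_sum_le fun i _ => by rw [← pow_mul, H.val_pow]
  -- The geometric sum reduces to m, a unit because the residue characteristic is zero.
  have hgeom : v (∑ j ∈ Finset.range m, (q ^ L) ^ j) = 1 := by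
    have e : ∑ j ∈ Finset.range m, (q ^ L) ^ j =
        (m : K) + -∑ j ∈ Finset.range m, (1 - (q ^ L) ^ j) := by
      simp [Finset.sum_sub_distrib]
    rw [e, v.map_add_eq_of_lt_left, H.val_natCast m hm]
    rw [Valuation.map_neg, H.val_natCast m hm]
    exact v.map_sum_lt one_ne_zero fun j _ => hsmall j
  rw [pow_mul, ← mul_neg_geom_sum, map_mul, hgeom, mul_one]

theorem mulClose_one_sub (H : IsPrimitiveRootMod v q L) {i : ℕ} (hi : ¬ L ∣ i) (m : ℕ) :
    MulClose v (v (1 - q ^ L)) (1 - q ^ (L * m + i)) (1 - q ^ i) := by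
  refine MulClose.of_sub_le (H.val_eq_one i hi) ?_
  have e : (1 - q ^ (L * m + i)) - (1 - q ^ i) = q ^ i * (1 - q ^ (L * m)) := by
    rw [pow_add]; ring
  rw [e, map_mul, H.val_pow, one_mul]
  rcases eq_or_ne m 0 with rfl | hm
  · simp
  · exact (H.val_one_sub_pow_mul hm).le

end IsPrimitiveRootMod

/-! ### q-shifted factorials in blocks of length L -/

namespace IsPrimitiveRootMod

variable {K Γ : Type*} [Field K] [LinearOrderedCommGroupWithZero Γ] {v : Valuation K Γ}
  {q : K} {L : ℕ}

theorem _root_.qPochhammer_pow (q : K) (b c k : ℕ) :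
    qPochhammer (q ^ c) (q ^ b) k = ∏ i ∈ Finset.range k, (1 - q ^ (b * i + c)) := by
  refine Finset.prod_congr rfl fun i _ => ?_
  rw [← pow_mul, ← pow_add, add_comm]

/-- The factor `1 - q ^ e`, replaced by `1` when `L` divides `e`. -/
def _root_.unitFactor (q : K) (L e : ℕ) : K :=
  if L ∣ e then 1 else 1 - q ^ e

theorem val_unitFactor (H : IsPrimitiveRootMod v q L) (e : ℕ) : v (unitFactor q L e) = 1 := by
  rw [unitFactor]
  split_ifs with h
  · exact map_one v
  · exact H.val_eq_one e h

theorem val_prod_unitFactor (H : IsPrimitiveRootMod v q L) (s : Finset ℕ) (e : ℕ → ℕ) :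
    v (∏ i ∈ s, unitFactor q L (e i)) = 1 := by
  rw [map_prod]
  exact Finset.prod_eq_one fun i _ => H.val_unitFactor _

theorem mulClose_unitFactor (H : IsPrimitiveRootMod v q L) (m e : ℕ) :
    MulClose v (v (1 - q ^ L)) (unitFactor q L (L * m + e)) (unitFactor q L e) := by
  have h0 : L ∣ L * m + e ↔ L ∣ e := (Nat.dvd_add_right (dvd_mul_right L m))
  simp only [unitFactor, h0]
  split_ifs with h
  · exact MulClose.refl one_ne_zero
  · exact H.mulClose_one_sub h m

/-- The product of the unit factors over one period of exponents. -/
def _root_.blockProd (q : K) (L : ℕ) : K :=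
  ∏ i ∈ Finset.range L, unitFactor q L i

theorem val_blockProd (H : IsPrimitiveRootMod v q L) : v (blockProd q L) = 1 :=
  H.val_prod_unitFactor _ _

/-- As b is coprime to L, the exponents b i + c meet each residue class modulo L once, and up to
closeness a unit factor depends only on the class. -/
theorem mulClose_block (H : IsPrimitiveRootMod v q L) {b : ℕ} (hb : Nat.Coprime L b)
    (hL : 0 < L) (c : ℕ) :
    MulClose v (v (1 - q ^ L)) (∏ i ∈ Finset.range L, unitFactor q L (b * i + c))
      (blockProd q L) := by
  have hinj : Set.InjOn (fun i => (b * i + c) % L) (Finset.range L) := by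
    intro i hi j hj hij
    simp only [Finset.coe_range, Set.mem_Iio] at hi hj
    have h1 : b * i ≡ b * j [MOD L] := Nat.ModEq.add_right_cancel' c hij
    have h2 : i ≡ j [MOD L] := Nat.ModEq.cancel_left_of_coprime hb h1
    exact h2.eq_of_lt_of_lt hi hj
  have himage : (Finset.range L).image (fun i => (b * i + c) % L) = Finset.range L := by
    refine Finset.eq_of_subset_of_card_le ?_ ?_
    · intro x hx
      obtain ⟨i, -, rfl⟩ := Finset.mem_image.mp hx
      exact Finset.mem_range.mpr (Nat.mod_lt _ hL)
    · rw [Finset.card_image_of_injOn hinj]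
  have e : blockProd q L = ∏ i ∈ Finset.range L, unitFactor q L ((b * i + c) % L) := by
    rw [blockProd]
    conv_lhs => rw [← himage]
    rw [Finset.prod_image hinj]
  rw [e]
  refine MulClose.prod H.val_lt fun i _ => ?_
  conv_lhs => rw [← Nat.div_add_mod (b * i + c) L]
  exact H.mulClose_unitFactor _ _

theorem mulClose_blocks (H : IsPrimitiveRootMod v q L) {b : ℕ} (hb : Nat.Coprime L b)
    (hL : 0 < L) (c s t : ℕ) :
    MulClose v (v (1 - q ^ L)) (∏ i ∈ Finset.range (L * s + t), unitFactor q L (b * i + c))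
      (blockProd q L ^ s * ∏ i ∈ Finset.range t, unitFactor q L (b * i + c)) := by
  induction s with
  | zero =>
    simp only [mul_zero, zero_add, pow_zero, one_mul]
    refine MulClose.refl fun h => ?_
    have := H.val_prod_unitFactor (Finset.range t) (fun i => b * i + c)
    simp [h] at this
  | succ s ih =>
    have e : L * (s + 1) + t = L + (L * s + t) := by ring
    rw [e, Finset.prod_range_add, pow_succ', mul_assoc]
    refine (H.mulClose_block hb hL c).mul H.val_lt (MulClose.trans H.val_lt ?_ ih)
    refine MulClose.prod H.val_lt fun i _ => ?_
    have e2 : b * (L + i) + c = L * b + (b * i + c) := by ring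
    rw [e2]
    exact H.mulClose_unitFactor _ _

/-- Split a `q`-shifted factorial into the factors with exponent divisible by `L`, which form a
`q ^ L`-shifted factorial, and the others. -/
theorem _root_.qPochhammer_eq_mul_prod_unitFactor (q : K) {b c c' i₀ k s : ℕ}
    (hb : Nat.Coprime L b) (hi₀ : i₀ < L) (hc : b * i₀ + c = L * c')
    (hs : ∀ j, L * j + i₀ < k ↔ j < s) :
    qPochhammer (q ^ c) (q ^ b) k =
      qPochhammer ((q ^ L) ^ c') ((q ^ L) ^ b) s *
        ∏ i ∈ Finset.range k, unitFactor q L (b * i + c) := by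
  have hL : 0 < L := by omega
  rw [qPochhammer_pow, qPochhammer_pow]
  -- The exponent is divisible by L exactly when i ≡ i₀ modulo L, and `hs` counts such i below k.
  have hfilter : (Finset.range k).filter (fun i => L ∣ b * i + c) =
      (Finset.range s).image (fun j => L * j + i₀) := by
    ext i
    simp only [Finset.mem_filter, Finset.mem_range, Finset.mem_image]
    constructor
    · rintro ⟨hik, hdvd⟩
      have h1 : b * i + c ≡ b * i₀ + c [MOD L] := by
        rw [hc]
        exact ((Nat.modEq_zero_iff_dvd).mpr hdvd).trans
          ((Nat.modEq_zero_iff_dvd).mpr (dvd_mul_right L c')).symm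
      have h2 : i ≡ i₀ [MOD L] :=
        Nat.ModEq.cancel_left_of_coprime hb (Nat.ModEq.add_right_cancel' c h1)
      have h3 : L * (i / L) + i₀ = i := by
        have := Nat.div_add_mod i L
        rw [Nat.ModEq, Nat.mod_eq_of_lt hi₀] at h2
        omega
      exact ⟨i / L, (hs _).mp (by rwa [h3]), h3⟩
    · rintro ⟨j, hj, rfl⟩
      refine ⟨(hs j).mpr hj, ⟨b * j + c', ?_⟩⟩
      rw [mul_add L, ← hc]; ring
  have hsplit : ∏ i ∈ Finset.range k, (1 - q ^ (b * i + c)) =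
      (∏ i ∈ Finset.range k, if L ∣ b * i + c then 1 - q ^ (b * i + c) else 1) *
        ∏ i ∈ Finset.range k, unitFactor q L (b * i + c) := by
    rw [← Finset.prod_mul_distrib]
    refine Finset.prod_congr rfl fun i _ => ?_
    rw [unitFactor]
    split_ifs <;> simp
  rw [hsplit, ← Finset.prod_filter, hfilter, Finset.prod_image]
  · congr 1
    refine Finset.prod_congr rfl fun j _ => ?_
    have e : b * (L * j + i₀) + c = L * (b * j + c') := by rw [mul_add L, ← hc]; ring
    rw [e, pow_mul]
  · intro i _ j _ hij
    exact Nat.eq_of_mul_eq_mul_left hL (Nat.add_right_cancel hij)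

theorem _root_.Nat.mul_add_lt_mul_add_iff_of_le {L i₀ s t : ℕ} (ht : t ≤ i₀) (hi₀ : i₀ < L)
    (j : ℕ) : L * j + i₀ < L * s + t ↔ j < s := by
  constructor
  · intro h
    by_contra! hj
    have := Nat.mul_le_mul_left L hj
    omega
  · intro h
    have := Nat.mul_le_mul_left L (Nat.succ_le_of_lt h)
    rw [Nat.mul_succ] at this
    omega

theorem _root_.Nat.mul_add_lt_mul_add_iff_of_lt {L i₀ s t : ℕ} (ht : i₀ < t) (htL : t ≤ L)
    (j : ℕ) : L * j + i₀ < L * s + t ↔ j < s + 1 := by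
  constructor
  · intro h
    by_contra! hj
    have := Nat.mul_le_mul_left L hj
    rw [Nat.mul_succ] at this
    omega
  · intro h
    have := Nat.mul_le_mul_left L (Nat.le_of_lt_succ h)
    omega

theorem qPochhammer_pow_ne_zero (H : IsPrimitiveRootMod v q L) {b c : ℕ} (hc : c ≠ 0) (k : ℕ) :
    qPochhammer (q ^ c) (q ^ b) k ≠ 0 := by
  rw [qPochhammer_pow, Finset.prod_ne_zero_iff]
  exact fun i _ => H.one_sub_ne_zero (by omega)

theorem qPochhammer_pow_root_ne_zero (H : IsPrimitiveRootMod v q L) (hL : L ≠ 0) {b c : ℕ}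
    (hc : c ≠ 0) (k : ℕ) : qPochhammer ((q ^ L) ^ c) ((q ^ L) ^ b) k ≠ 0 := by
  rw [← pow_mul, ← pow_mul]
  exact H.qPochhammer_pow_ne_zero (mul_ne_zero hL hc) k

/-- The incomplete block stops before its index i₀, so only the s full blocks contribute an exponent
divisible by L. -/
theorem mulClose_qPochhammer_of_le (H : IsPrimitiveRootMod v q L) {b c c' i₀ : ℕ}
    (hb : Nat.Coprime L b) (hc0 : c' ≠ 0) (hi₀ : i₀ < L) (hc : b * i₀ + c = L * c') (s : ℕ)
    {t : ℕ} (ht : t ≤ i₀) :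
    MulClose v (v (1 - q ^ L)) (qPochhammer (q ^ c) (q ^ b) (L * s + t))
      (qPochhammer ((q ^ L) ^ c') ((q ^ L) ^ b) s * blockProd q L ^ s *
        qPochhammer (q ^ c) (q ^ b) t) := by
  have h0 := qPochhammer_eq_mul_prod_unitFactor q hb hi₀ hc (k := t) (s := 0)
    (by simpa using Nat.mul_add_lt_mul_add_iff_of_le (s := 0) ht hi₀)
  rw [qPochhammer_eq_mul_prod_unitFactor q hb hi₀ hc
    (Nat.mul_add_lt_mul_add_iff_of_le (s := s) ht hi₀), h0, qPochhammer_zero, one_mul, mul_assoc]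
  exact MulClose.mul H.val_lt (MulClose.refl (H.qPochhammer_pow_root_ne_zero (by omega) hc0 s))
    (H.mulClose_blocks hb (by omega) c s t)

/-- Here the incomplete block passes i₀. Its small factor 1 - q^(L c') is counted twice on the
right, in both Pochhammer symbols, and is compensated on the left. -/
theorem mulClose_qPochhammer_of_lt (H : IsPrimitiveRootMod v q L) {b c c' i₀ : ℕ}
    (hb : Nat.Coprime L b) (hc0 : c' ≠ 0) (hi₀ : i₀ < L) (hc : b * i₀ + c = L * c') (s : ℕ)
    {t : ℕ} (ht : i₀ < t) (htL : t ≤ L) :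
    MulClose v (v (1 - q ^ L))
      (qPochhammer (q ^ c) (q ^ b) (L * s + t) * (1 - q ^ (L * c')))
      (qPochhammer ((q ^ L) ^ c') ((q ^ L) ^ b) (s + 1) * blockProd q L ^ s *
        qPochhammer (q ^ c) (q ^ b) t) := by
  have h0 := qPochhammer_eq_mul_prod_unitFactor q hb hi₀ hc (k := t) (s := 1)
    (by simpa using Nat.mul_add_lt_mul_add_iff_of_lt (s := 0) ht htL)
  have h1 : qPochhammer ((q ^ L) ^ c') ((q ^ L) ^ b) 1 = 1 - q ^ (L * c') := by
    simp [qPochhammer, pow_mul]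
  have hne : ∀ k, qPochhammer ((q ^ L) ^ c') ((q ^ L) ^ b) k ≠ 0 := fun k =>
    H.qPochhammer_pow_root_ne_zero (by omega) hc0 k
  rw [qPochhammer_eq_mul_prod_unitFactor q hb hi₀ hc
    (Nat.mul_add_lt_mul_add_iff_of_lt (s := s) ht htL), h0, h1]
  have := MulClose.mul H.val_lt (MulClose.refl (v := v) (δ := v (1 - q ^ L)) (hne (s + 1)))
    ((H.mulClose_blocks hb (by omega) c s t).mul H.val_lt
      (MulClose.refl (v := v) (δ := v (1 - q ^ L)) (h1 ▸ hne 1)))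
  convert this using 1 <;> ring

theorem val_qPochhammer_pow_root (H : IsPrimitiveRootMod v q L) {b c : ℕ} (hc : c ≠ 0) (s : ℕ) :
    v (qPochhammer ((q ^ L) ^ c) ((q ^ L) ^ b) s) = v (1 - q ^ L) ^ s := by
  rw [qPochhammer_pow, map_prod]
  refine (Finset.prod_eq_pow_card fun i _ => ?_).trans (by rw [Finset.card_range])
  rw [← pow_mul]
  exact H.val_one_sub_pow_mul (by omega)

theorem val_qPochhammer_of_le (H : IsPrimitiveRootMod v q L) {b c c' i₀ : ℕ}
    (hb : Nat.Coprime L b) (hc0 : c' ≠ 0) (hi₀ : i₀ < L) (hc : b * i₀ + c = L * c') (s : ℕ)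
    {t : ℕ} (ht : t ≤ i₀) :
    v (qPochhammer (q ^ c) (q ^ b) (L * s + t)) = v (1 - q ^ L) ^ s := by
  rw [qPochhammer_eq_mul_prod_unitFactor q hb hi₀ hc
    (Nat.mul_add_lt_mul_add_iff_of_le (s := s) ht hi₀), map_mul, H.val_prod_unitFactor, mul_one,
    H.val_qPochhammer_pow_root hc0]

theorem val_qPochhammer_of_lt (H : IsPrimitiveRootMod v q L) {b c c' i₀ : ℕ}
    (hb : Nat.Coprime L b) (hc0 : c' ≠ 0) (hi₀ : i₀ < L) (hc : b * i₀ + c = L * c') (s : ℕ)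
    {t : ℕ} (ht : i₀ < t) (htL : t ≤ L) :
    v (qPochhammer (q ^ c) (q ^ b) (L * s + t)) = v (1 - q ^ L) ^ (s + 1) := by
  rw [qPochhammer_eq_mul_prod_unitFactor q hb hi₀ hc
    (Nat.mul_add_lt_mul_add_iff_of_lt (s := s) ht htL), map_mul, H.val_prod_unitFactor, mul_one,
    H.val_qPochhammer_pow_root hc0]

end IsPrimitiveRootMod

/-! ### Lucas-type congruences for the summand and its sums -/

/-- The summand `(q; q²)_k² (q²; q⁴)_k / ((q²; q²)_k² (q⁴; q⁴)_k) q ^ (2 k)`. -/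
def dworkTerm {K : Type*} [Field K] (q : K) (k : ℕ) : K :=
  qPochhammer q (q ^ 2) k ^ 2 * qPochhammer (q ^ 2) (q ^ 4) k /
    (qPochhammer (q ^ 2) (q ^ 2) k ^ 2 * qPochhammer (q ^ 4) (q ^ 4) k) * q ^ (2 * k)

/-- The sum of the terms that do not vanish at a primitive `L`-th root of unity. -/
def dworkSum {K : Type*} [Field K] (q : K) (L : ℕ) : K :=
  ∑ t ∈ Finset.range ((L + 1) / 2), dworkTerm q t

theorem Finset.sum_range_mul_eq {M : Type*} [AddCommMonoid M] (f : ℕ → M) (L s : ℕ) :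
    ∑ k ∈ Finset.range (L * s), f k =
      ∑ i ∈ Finset.range s, ∑ t ∈ Finset.range L, f (L * i + t) := by
  induction s with
  | zero => simp
  | succ s ih => rw [Nat.mul_succ, Finset.sum_range_add, ih, Finset.sum_range_succ]

namespace IsPrimitiveRootMod

variable {K Γ : Type*} [Field K] [LinearOrderedCommGroupWithZero Γ] {v : Valuation K Γ}
  {q : K} {L : ℕ}

theorem coprime_two (hL : L % 4 = 1) : Nat.Coprime L 2 :=
  (Nat.coprime_two_right).mpr (Nat.odd_iff.mpr (by omega))

theorem coprime_four (hL : L % 4 = 1) : Nat.Coprime L 4 :=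
  (coprime_two hL).pow_right 2

theorem val_ne_zero (H : IsPrimitiveRootMod v q L) (hL : L ≠ 0) : v (1 - q ^ L) ≠ 0 :=
  (Valuation.ne_zero_iff v).mpr (H.one_sub_ne_zero hL)

/-- The indices i₀ solve 2i₀ + 1 = L and 4i₀ + 2 = 2L in the numerator, 2i₀ + 2 = 2L and 4i₀ + 4 =
4L in the denominator. None is passed when t ≤ (L-1)/2, and the block products cancel, three against
three. -/
theorem mulClose_dworkTerm (H : IsPrimitiveRootMod v q L) (hL : L % 4 = 1) (s : ℕ) {t : ℕ}
    (ht : t ≤ (L - 1) / 2) :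
    MulClose v (v (1 - q ^ L)) (dworkTerm q (L * s + t))
      (dworkTerm (q ^ L) s * dworkTerm q t) := by
  have h1 := H.mulClose_qPochhammer_of_le (b := 2) (c := 1) (c' := 1) (i₀ := (L - 1) / 2)
    (coprime_two hL) one_ne_zero (by omega) (by omega) s ht
  have h2 := H.mulClose_qPochhammer_of_le (b := 4) (c := 2) (c' := 2) (i₀ := (L - 1) / 2)
    (coprime_four hL) two_ne_zero (by omega) (by omega) s ht
  have h3 := H.mulClose_qPochhammer_of_le (b := 2) (c := 2) (c' := 2) (i₀ := L - 1)
    (coprime_two hL) two_ne_zero (by omega) (by omega) s (t := t) (by omega)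
  have h4 := H.mulClose_qPochhammer_of_le (b := 4) (c := 4) (c' := 4) (i₀ := L - 1)
    (coprime_four hL) four_ne_zero (by omega) (by omega) s (t := t) (by omega)
  rw [pow_one, pow_one] at h1
  have hδ := H.val_lt
  have h := ((((h1.pow hδ 2).mul hδ h2).div hδ ((h3.pow hδ 2).mul hδ h4)).mul hδ
    (MulClose.refl (v := v) (δ := v (1 - q ^ L)) (pow_ne_zero (2 * (L * s + t)) H.ne_zero)))
  have hB : blockProd q L ≠ 0 := by
    intro h0
    simpa [h0] using H.val_blockProd
  have e3 := H.qPochhammer_pow_root_ne_zero (b := 2) (c := 2) (by omega) two_ne_zero s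
  have e4 := H.qPochhammer_pow_root_ne_zero (b := 4) (c := 4) (by omega) four_ne_zero s
  have e3' := H.qPochhammer_pow_ne_zero (b := 2) (c := 2) two_ne_zero t
  have e4' := H.qPochhammer_pow_ne_zero (b := 4) (c := 4) four_ne_zero t
  rw [dworkTerm]
  refine (congrArg (MulClose v _ _) ?_).mp h
  rw [dworkTerm, dworkTerm]
  have e5 : q ^ (2 * (L * s + t)) = (q ^ L) ^ (2 * s) * q ^ (2 * t) := by
    rw [← pow_mul, ← pow_add]; ring_nf
  rw [e5]
  field_simp

theorem val_dworkTerm_of_le (H : IsPrimitiveRootMod v q L) (hL : L % 4 = 1) (s : ℕ) {t : ℕ}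
    (ht : t ≤ (L - 1) / 2) : v (dworkTerm q (L * s + t)) = 1 := by
  have h1 := H.val_qPochhammer_of_le (b := 2) (c := 1) (c' := 1) (i₀ := (L - 1) / 2)
    (coprime_two hL) one_ne_zero (by omega) (by omega) s ht
  have h2 := H.val_qPochhammer_of_le (b := 4) (c := 2) (c' := 2) (i₀ := (L - 1) / 2)
    (coprime_four hL) two_ne_zero (by omega) (by omega) s ht
  have h3 := H.val_qPochhammer_of_le (b := 2) (c := 2) (c' := 2) (i₀ := L - 1)
    (coprime_two hL) two_ne_zero (by omega) (by omega) s (t := t) (by omega)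
  have h4 := H.val_qPochhammer_of_le (b := 4) (c := 4) (c' := 4) (i₀ := L - 1)
    (coprime_four hL) four_ne_zero (by omega) (by omega) s (t := t) (by omega)
  rw [pow_one] at h1
  have hδ := H.val_ne_zero (by omega)
  simp only [dworkTerm, map_mul, map_div₀, map_pow, h1, h2, h3, h4, H.val_self]
  field_simp
  simp

/-- Past the middle of the block each of the three numerator symbols has gained one more small
factor, and the denominator none. -/
theorem val_dworkTerm_of_lt (H : IsPrimitiveRootMod v q L) (hL : L % 4 = 1) (s : ℕ) {t : ℕ}
    (ht : (L - 1) / 2 < t) (htL : t < L) :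
    v (dworkTerm q (L * s + t)) = v (1 - q ^ L) ^ 3 := by
  have h1 := H.val_qPochhammer_of_lt (b := 2) (c := 1) (c' := 1) (i₀ := (L - 1) / 2)
    (coprime_two hL) one_ne_zero (by omega) (by omega) s ht htL.le
  have h2 := H.val_qPochhammer_of_lt (b := 4) (c := 2) (c' := 2) (i₀ := (L - 1) / 2)
    (coprime_four hL) two_ne_zero (by omega) (by omega) s ht htL.le
  have h3 := H.val_qPochhammer_of_le (b := 2) (c := 2) (c' := 2) (i₀ := L - 1)
    (coprime_two hL) two_ne_zero (by omega) (by omega) s (t := t) (by omega)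
  have h4 := H.val_qPochhammer_of_le (b := 4) (c := 4) (c' := 4) (i₀ := L - 1)
    (coprime_four hL) four_ne_zero (by omega) (by omega) s (t := t) (by omega)
  rw [pow_one] at h1
  have hδ := H.val_ne_zero (by omega)
  simp only [dworkTerm, map_mul, map_div₀, map_pow, h1, h2, h3, h4, H.val_self, one_pow, mul_one,
    pow_succ (v (1 - q ^ L)) s]
  field_simp

theorem val_dworkTerm_pow_root (H : IsPrimitiveRootMod v q L) (hL : L ≠ 0) (s : ℕ) :
    v (dworkTerm (q ^ L) s) = 1 := by
  have h1 := H.val_qPochhammer_pow_root (b := 2) (c := 1) one_ne_zero s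
  have h2 := H.val_qPochhammer_pow_root (b := 4) (c := 2) two_ne_zero s
  have h3 := H.val_qPochhammer_pow_root (b := 2) (c := 2) two_ne_zero s
  have h4 := H.val_qPochhammer_pow_root (b := 4) (c := 4) four_ne_zero s
  rw [pow_one] at h1
  have hδ := H.val_ne_zero hL
  simp only [dworkTerm, map_mul, map_div₀, h1, h2, h3, h4, map_pow, H.val_self]
  field_simp
  simp

theorem sum_half_block (H : IsPrimitiveRootMod v q L) (hL : L % 4 = 1) (s : ℕ) :
    v (∑ t ∈ Finset.range ((L + 1) / 2), dworkTerm q (L * s + t) -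
      dworkTerm (q ^ L) s * dworkSum q L) ≤ v (1 - q ^ L) := by
  rw [dworkSum, Finset.mul_sum, ← Finset.sum_sub_distrib]
  refine v.map_sum_le fun t ht => ?_
  rw [Finset.mem_range] at ht
  have h := H.mulClose_dworkTerm hL s (t := t) (by omega)
  refine h.sub_le (h.right_ne_zero H.val_lt) ?_
  rw [← h.val_eq H.val_lt]
  exact (H.val_dworkTerm_of_le hL s (by omega)).le

theorem sum_block (H : IsPrimitiveRootMod v q L) (hL : L % 4 = 1) (s : ℕ) :
    v (∑ t ∈ Finset.range L, dworkTerm q (L * s + t) -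
      dworkTerm (q ^ L) s * dworkSum q L) ≤ v (1 - q ^ L) := by
  have e : L = (L + 1) / 2 + (L - (L + 1) / 2) := by omega
  have e2 : ∑ t ∈ Finset.range L, dworkTerm q (L * s + t) =
      ∑ t ∈ Finset.range ((L + 1) / 2), dworkTerm q (L * s + t) +
      ∑ t ∈ Finset.range (L - (L + 1) / 2), dworkTerm q (L * s + ((L + 1) / 2 + t)) := by
    rw [← Finset.sum_range_add fun t => dworkTerm q (L * s + t), ← e]
  rw [e2, add_sub_right_comm]
  refine v.map_add_le (H.sum_half_block hL s) (v.map_sum_le fun t ht => ?_)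
  rw [Finset.mem_range] at ht
  rw [H.val_dworkTerm_of_lt hL s (by omega) (by omega)]
  simpa using pow_le_pow_right_of_le_one' H.val_lt.le (show 1 ≤ 3 by norm_num)

theorem sum_blocks (H : IsPrimitiveRootMod v q L) (hL : L % 4 = 1) (s : ℕ) :
    v (∑ k ∈ Finset.range (L * s), dworkTerm q k -
      dworkSum q L * ∑ i ∈ Finset.range s, dworkTerm (q ^ L) i) ≤ v (1 - q ^ L) := by
  rw [Finset.sum_range_mul_eq, Finset.mul_sum, ← Finset.sum_sub_distrib]
  refine v.map_sum_le fun i _ => ?_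
  rw [mul_comm (dworkSum q L)]
  exact H.sum_block hL i

/-- The truncated sum factors modulo a single power of the prime. -/
theorem sum_dworkTerm_sub_le (H : IsPrimitiveRootMod v q L) (hL : L % 4 = 1) {m d : ℕ}
    (hm : m % 2 = 1) (hd : d = 1 ∨ d = 2) :
    v (∑ k ∈ Finset.range ((L * m - 1) / d + 1), dworkTerm q k -
      dworkSum q L * ∑ i ∈ Finset.range ((m - 1) / d + 1), dworkTerm (q ^ L) i) ≤
        v (1 - q ^ L) := by
  rcases hd with rfl | rfl
  · have hpos : 0 < L * m := Nat.mul_pos (by omega) (by omega)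
    rw [Nat.div_one, Nat.div_one, Nat.sub_add_cancel hpos, Nat.sub_add_cancel (by omega)]
    exact H.sum_blocks hL m
  · obtain ⟨s, rfl⟩ : ∃ s, m = 2 * s + 1 := ⟨m / 2, by omega⟩
    -- For d = 2 the range ends at the middle of block s, where the non-negligible half of that
    -- block ends.
    have e : (L * (2 * s + 1) - 1) / 2 + 1 = L * s + (L + 1) / 2 := by
      have : L * (2 * s + 1) = 2 * (L * s) + L := by ring
      omega
    have e2 : (2 * s + 1 - 1) / 2 + 1 = s + 1 := by omega
    rw [e, e2, Finset.sum_range_add, Finset.sum_range_succ _ s, mul_add, add_sub_add_comm]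
    refine v.map_add_le (H.sum_blocks hL s) ?_
    rw [mul_comm (dworkSum q L)]
    exact H.sum_half_block hL s

/-- Within one block the only error is the discarded second half, of third order. -/
theorem sum_dworkTerm_sub_le_sq (H : IsPrimitiveRootMod v q L) (hL : L % 4 = 1) {d : ℕ}
    (hd : d = 1 ∨ d = 2) :
    v (∑ k ∈ Finset.range ((L - 1) / d + 1), dworkTerm q k - dworkSum q L) ≤
      v (1 - q ^ L) ^ 2 := by
  have e : (L - 1) / d + 1 = (L + 1) / 2 + ((L - 1) / d + 1 - (L + 1) / 2) := by
    rcases hd with rfl | rfl <;> omega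
  rw [e, Finset.sum_range_add, dworkSum, add_sub_cancel_left]
  refine v.map_sum_le fun t ht => ?_
  rw [Finset.mem_range] at ht
  have htL : (L + 1) / 2 + t < L := by rcases hd with rfl | rfl <;> omega
  have := H.val_dworkTerm_of_lt hL 0 (t := (L + 1) / 2 + t) (by omega) htL
  rw [mul_zero, zero_add] at this
  rw [this]
  exact pow_le_pow_right_of_le_one' H.val_lt.le (by norm_num)

end IsPrimitiveRootMod

/-! ### Evaluation of the half sum as a product -/

/-- The product `(1 - q ^ L) (q³; q⁴)_{(L - 1) / 2} / (q; q⁴)_{(L + 1) / 2}`. -/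
def dworkProd {K : Type*} [Field K] (q : K) (L : ℕ) : K :=
  (1 - q ^ L) * qPochhammer (q ^ 3) (q ^ 4) ((L - 1) / 2) / qPochhammer q (q ^ 4) ((L + 1) / 2)

theorem Finset.prod_range_two_mul_pair {M : Type*} [CommMonoid M] (f : ℕ → M) (h : ℕ) :
    ∏ i ∈ Finset.range (2 * h), f i =
      ∏ j ∈ Finset.range h, f (h - 1 - j) * f (h + j) := by
  rw [two_mul, Finset.prod_range_add, Finset.prod_mul_distrib, Finset.prod_range_reflect]

theorem Finset.prod_range_two_mul_add_one_pair {M : Type*} [CommMonoid M] (f : ℕ → M) (h : ℕ) :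
    ∏ i ∈ Finset.range (2 * h + 1), f i =
      f h * ∏ j ∈ Finset.range h, f (h - 1 - j) * f (h + 1 + j) := by
  have e : 2 * h + 1 = (h + 1) + h := by ring
  rw [e, Finset.prod_range_add, Finset.prod_mul_distrib, Finset.prod_range_reflect,
    Finset.prod_range_succ, mul_comm (∏ i ∈ Finset.range h, f i), mul_assoc]

namespace IsPrimitiveRootMod

variable {K Γ : Type*} [Field K] [LinearOrderedCommGroupWithZero Γ] {v : Valuation K Γ}
  {q : K} {L : ℕ}

theorem sq_val_lt (H : IsPrimitiveRootMod v q L) : v (1 - q ^ L) ^ 2 < 1 :=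
  pow_lt_one' H.val_lt two_ne_zero

/-- With y = q^(2i+1) and u = q^L, (1 - y/u)(1 - yu) = (1 - y)² - (y/u)(1 - u)². The symmetry u ↔
1/u makes the error quadratic. -/
theorem mulClose_watsonFactor (H : IsPrimitiveRootMod v q L) {h i : ℕ} (hL : L = 4 * h + 1)
    (hi : i < 2 * h) :
    MulClose v (v (1 - q ^ L) ^ 2)
      ((1 - ((q ^ 2) ^ (2 * h))⁻¹ * (q ^ 2) ^ i) * (1 - (q ^ 2) ^ (2 * h) * q ^ 2 * (q ^ 2) ^ i))
      ((1 - q * (q ^ 2) ^ i) ^ 2) := by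
  have hy : q * (q ^ 2) ^ i = q ^ (2 * i + 1) := by ring
  refine MulClose.of_sub_le ?_ ?_
  · rw [hy, map_pow, H.val_eq_one _ (Nat.not_dvd_of_pos_of_lt (by omega) (by omega)), one_pow]
  · have hq := H.ne_zero
    have e : (1 - ((q ^ 2) ^ (2 * h))⁻¹ * (q ^ 2) ^ i) *
        (1 - (q ^ 2) ^ (2 * h) * q ^ 2 * (q ^ 2) ^ i) - (1 - q * (q ^ 2) ^ i) ^ 2 =
        -(q ^ (2 * i) / q ^ (4 * h)) * (1 - q ^ L) ^ 2 := by
      have e1 : (q ^ 2) ^ (2 * h) = q ^ (4 * h) := by ring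
      have e2 : (q ^ 2) ^ i = q ^ (2 * i) := by ring
      rw [e1, e2, hL, pow_succ]
      field_simp
      ring
    rw [e, map_mul, map_pow, Valuation.map_neg, map_div₀, H.val_pow, H.val_pow, div_one, one_mul]

theorem mulClose_watsonTerm (H : IsPrimitiveRootMod v q L) {h k : ℕ} (hL : L = 4 * h + 1)
    (hk : k ≤ 2 * h) :
    MulClose v (v (1 - q ^ L) ^ 2)
      (watsonTerm (q ^ 2) ((q ^ 2) ^ (2 * h)) ((q ^ 2) ^ (2 * h))⁻¹ k) (dworkTerm q k) := by
  have h1 : MulClose v (v (1 - q ^ L) ^ 2)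
      (qPochhammer ((q ^ 2) ^ (2 * h))⁻¹ (q ^ 2) k *
        qPochhammer ((q ^ 2) ^ (2 * h) * q ^ 2) (q ^ 2) k)
      (qPochhammer q (q ^ 2) k ^ 2) := by
    simp only [qPochhammer]
    rw [← Finset.prod_mul_distrib, ← Finset.prod_pow]
    exact MulClose.prod H.sq_val_lt fun i hi =>
      H.mulClose_watsonFactor hL (by rw [Finset.mem_range] at hi; omega)
  have e1 := H.qPochhammer_pow_ne_zero (b := 4) (c := 2) two_ne_zero k
  have e2 := H.qPochhammer_pow_ne_zero (b := 2) (c := 2) two_ne_zero k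
  have e3 := H.qPochhammer_pow_ne_zero (b := 4) (c := 4) four_ne_zero k
  have e4 : (q ^ 2) ^ 2 = q ^ 4 := by ring
  have h2 := h1.mul H.sq_val_lt (MulClose.refl (v := v) (δ := v (1 - q ^ L) ^ 2)
    (x := watsonCoeff (q ^ 2) k * (q ^ 2) ^ k)
    (mul_ne_zero (by rw [watsonCoeff, e4]; exact div_ne_zero e1 (mul_ne_zero (pow_ne_zero 2 e2) e3))
      (pow_ne_zero _ (pow_ne_zero _ H.ne_zero))))
  convert h2 using 1
  · rw [watsonTerm]; ring
  · rw [dworkTerm, watsonCoeff, e4, ← pow_mul]; ring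

/-- The Watson sum in base q² with x = q^(L-1) has support k ≤ 2h = (L-1)/2, precisely the half
period. -/
theorem dworkSum_sub_le (H : IsPrimitiveRootMod v q L) {h : ℕ} (hL : L = 4 * h + 1) :
    v (dworkSum q L - q ^ (2 * h) * qPochhammer (q ^ 2) (q ^ 4) h ^ 2 /
      qPochhammer (q ^ 4) (q ^ 4) h ^ 2) ≤ v (1 - q ^ L) ^ 2 := by
  have hW := sum_watsonTerm (q := q ^ 2) (pow_ne_zero 2 H.ne_zero)
    (fun i hi => by rw [← pow_mul]; exact H.pow_ne_one _ (by omega)) h (2 * h + 1) (by omega)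
  have e4 : (q ^ 2) ^ 2 = q ^ 4 := by ring
  rw [e4, ← pow_mul q 2 h] at hW
  have e5 : (L + 1) / 2 = 2 * h + 1 := by omega
  rw [← hW, dworkSum, e5, ← Finset.sum_sub_distrib]
  refine v.map_sum_le fun k hk => ?_
  rw [Finset.mem_range] at hk
  have hc := (H.mulClose_watsonTerm hL (k := k) (by omega)).symm H.sq_val_lt
  refine hc.sub_le (hc.right_ne_zero H.sq_val_lt) ?_
  rw [← hc.val_eq H.sq_val_lt]
  have := H.val_dworkTerm_of_le (by omega) 0 (t := k) (by omega)
  rw [mul_zero, zero_add] at this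
  exact this.le

theorem mulClose_pair (H : IsPrimitiveRootMod v q L) {x : ℕ} (hx0 : x ≠ 0) (hx : x < L) :
    MulClose v (v (1 - q ^ L) ^ 2) ((1 - q ^ (L - x)) * (1 - q ^ (L + x)))
      (-q ^ (L - x) * (1 - q ^ x) ^ 2) := by
  refine MulClose.of_sub_le ?_ ?_
  · rw [map_mul, Valuation.map_neg, H.val_pow, one_mul, map_pow,
      H.val_eq_one _ (Nat.not_dvd_of_pos_of_lt (by omega) hx), one_pow]
  · have e1 : q ^ L = q ^ (L - x) * q ^ x := by rw [← pow_add]; congr 1; omega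
    have e : (1 - q ^ (L - x)) * (1 - q ^ (L + x)) - -q ^ (L - x) * (1 - q ^ x) ^ 2 =
        (1 - q ^ L) ^ 2 := by
      rw [pow_add, e1]; ring
    rw [e, map_pow]

/-- The exponents in both symbols are symmetric about L. The central factor 1 - q^L of the
denominator cancels the one in `dworkProd`, and each pair L ± x is a square up to a quadratic error.
-/
theorem mulClose_dworkProd (H : IsPrimitiveRootMod v q L) {h : ℕ} (hL : L = 4 * h + 1) :
    MulClose v (v (1 - q ^ L) ^ 2) (dworkProd q L)
      (q ^ (2 * h) * qPochhammer (q ^ 2) (q ^ 4) h ^ 2 / qPochhammer (q ^ 4) (q ^ 4) h ^ 2) := by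
  have hq := H.ne_zero
  have h3 : qPochhammer (q ^ 3) (q ^ 4) ((L - 1) / 2) =
      ∏ j ∈ Finset.range h, (1 - q ^ (L - (4 * j + 2))) * (1 - q ^ (L + (4 * j + 2))) := by
    rw [show (L - 1) / 2 = 2 * h by omega, qPochhammer_pow, Finset.prod_range_two_mul_pair]
    refine Finset.prod_congr rfl fun j hj => ?_
    rw [Finset.mem_range] at hj
    rw [show 4 * (h - 1 - j) + 3 = L - (4 * j + 2) by omega,
      show 4 * (h + j) + 3 = L + (4 * j + 2) by omega]
  have h1 : qPochhammer q (q ^ 4) ((L + 1) / 2) = (1 - q ^ L) *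
      ∏ j ∈ Finset.range h, (1 - q ^ (L - (4 * j + 4))) * (1 - q ^ (L + (4 * j + 4))) := by
    have := qPochhammer_pow q 4 1 ((L + 1) / 2)
    rw [pow_one] at this
    rw [this, show (L + 1) / 2 = 2 * h + 1 by omega, Finset.prod_range_two_mul_add_one_pair,
      ← hL]
    congr 1
    refine Finset.prod_congr rfl fun j hj => ?_
    rw [Finset.mem_range] at hj
    rw [show 4 * (h - 1 - j) + 1 = L - (4 * j + 4) by omega,
      show 4 * (h + 1 + j) + 1 = L + (4 * j + 4) by omega]
  have c3 := MulClose.prod H.sq_val_lt (s := Finset.range h) fun j hj =>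
    H.mulClose_pair (x := 4 * j + 2) (by omega) (by rw [Finset.mem_range] at hj; omega)
  have c1 := MulClose.prod H.sq_val_lt (s := Finset.range h) fun j hj =>
    H.mulClose_pair (x := 4 * j + 4) (by omega) (by rw [Finset.mem_range] at hj; omega)
  have hL0 : 1 - q ^ L ≠ 0 := H.one_sub_ne_zero (by omega)
  rw [dworkProd, h3, h1, mul_div_mul_left _ _ hL0]
  refine (congrArg (MulClose v _ _) ?_).mp (c3.div H.sq_val_lt c1)
  -- Signs cancel, and each j contributes q²; together these give q^(2h).
  have e : ∀ j ∈ Finset.range h, -q ^ (L - (4 * j + 2)) * (1 - q ^ (4 * j + 2)) ^ 2 /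
      (-q ^ (L - (4 * j + 4)) * (1 - q ^ (4 * j + 4)) ^ 2) =
      q ^ 2 * ((1 - q ^ (4 * j + 2)) ^ 2 / (1 - q ^ (4 * j + 4)) ^ 2) := by
    intro j hj
    rw [Finset.mem_range] at hj
    have e1 : q ^ (L - (4 * j + 2)) = q ^ (L - (4 * j + 4)) * q ^ 2 := by
      rw [← pow_add]; congr 1; omega
    have e2 : 1 - q ^ (4 * j + 4) ≠ 0 := H.one_sub_ne_zero (by omega)
    rw [e1]
    field_simp
  rw [← Finset.prod_div_distrib, Finset.prod_congr rfl e, Finset.prod_mul_distrib,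
    Finset.prod_div_distrib, Finset.prod_const, Finset.card_range, ← pow_mul, Finset.prod_pow,
    Finset.prod_pow, qPochhammer_pow, qPochhammer_pow, mul_div_assoc]

/-- The half sum and the product agree modulo the square of the prime. -/
theorem dworkSum_sub_dworkProd_le (H : IsPrimitiveRootMod v q L) (hL : L % 4 = 1) :
    v (dworkSum q L - dworkProd q L) ≤ v (1 - q ^ L) ^ 2 ∧ v (dworkProd q L) = 1 := by
  obtain ⟨h, hh⟩ : ∃ h, L = 4 * h + 1 := ⟨L / 4, by omega⟩
  have h1 := H.dworkSum_sub_le hh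
  have h2 := H.mulClose_dworkProd hh
  set A := q ^ (2 * h) * qPochhammer (q ^ 2) (q ^ 4) h ^ 2 / qPochhammer (q ^ 4) (q ^ 4) h ^ 2
  have hA : v A = 1 := by
    have h3 := H.val_qPochhammer_of_le (b := 4) (c := 2) (c' := 2) (i₀ := (L - 1) / 2)
      (coprime_four hL) two_ne_zero (by omega) (by omega) 0 (t := h) (by omega)
    have h4 := H.val_qPochhammer_of_le (b := 4) (c := 4) (c' := 4) (i₀ := L - 1)
      (coprime_four hL) four_ne_zero (by omega) (by omega) 0 (t := h) (by omega)
    rw [mul_zero, zero_add] at h3 h4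
    simp only [A, map_mul, map_div₀, map_pow, h3, h4, H.val_self]
    simp
  refine ⟨?_, (h2.val_eq H.sq_val_lt).trans hA⟩
  have h5 := h2.sub_le (h2.right_ne_zero H.sq_val_lt) hA.le
  rw [← sub_sub_sub_cancel_right _ _ A]
  exact v.map_sub_le h1 h5

/-- The product factors modulo a single power of the prime. -/
theorem mulClose_dworkProd_mul (H : IsPrimitiveRootMod v q L) (hL : L % 4 = 1) {m : ℕ}
    (hm : m % 2 = 1) :
    MulClose v (v (1 - q ^ L)) (dworkProd q (L * m)) (dworkProd (q ^ L) m * dworkProd q L) := by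
  obtain ⟨s, rfl⟩ : ∃ s, m = 2 * s + 1 := ⟨m / 2, by omega⟩
  have e : L * (2 * s + 1) = 2 * (L * s) + L := by ring
  -- Solving 4i₀ + 3 = 3L gives i₀ = 3(L-1)/4, not reached by t = (L-1)/2; solving 4i₀ + 1 = L gives
  -- (L-1)/4, which (L+1)/2 passes. The resulting extra 1 - q^L is the one in `dworkProd q L`.
  have h1 := H.mulClose_qPochhammer_of_le (b := 4) (c := 3) (c' := 3) (i₀ := 3 * ((L - 1) / 4))
    (coprime_four hL) three_ne_zero (by omega) (by omega) s (t := (L - 1) / 2) (by omega)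
  have h2 := H.mulClose_qPochhammer_of_lt (b := 4) (c := 1) (c' := 1) (i₀ := (L - 1) / 4)
    (coprime_four hL) one_ne_zero (by omega) (by omega) s (t := (L + 1) / 2) (by omega) (by omega)
  have e1 : (L * (2 * s + 1) - 1) / 2 = L * s + (L - 1) / 2 := by omega
  have e2 : (L * (2 * s + 1) + 1) / 2 = L * s + (L + 1) / 2 := by omega
  have e3 : (2 * s + 1 - 1) / 2 = s := by omega
  have e4 : (2 * s + 1 + 1) / 2 = s + 1 := by omega
  have n0 : 1 - q ^ L ≠ 0 := H.one_sub_ne_zero (by omega)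
  have nB : blockProd q L ≠ 0 := by
    intro h0
    simpa [h0] using H.val_blockProd
  have n1 := H.qPochhammer_pow_root_ne_zero (b := 4) (c := 1) (by omega) one_ne_zero (s + 1)
  have n2 := H.qPochhammer_pow_ne_zero (b := 4) (c := 1) one_ne_zero ((L + 1) / 2)
  have n3 := H.qPochhammer_pow_ne_zero (b := 4) (c := 1) one_ne_zero (L * s + (L + 1) / 2)
  have n4 : (1 - q ^ (L * (2 * s + 1))) * (1 - q ^ L) ≠ 0 :=
    mul_ne_zero (H.one_sub_ne_zero (by omega)) n0
  have h3 := (MulClose.refl (v := v) (δ := v (1 - q ^ L)) n4).mul H.val_lt (h1.div H.val_lt h2)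
  simp only [pow_one, mul_one] at h3 n1 n2 n3
  rw [dworkProd, dworkProd, dworkProd, e1, e2, e3, e4, ← pow_mul q L (2 * s + 1)]
  convert h3 using 1 <;> field_simp

end IsPrimitiveRootMod

/-! ### The congruence at a single prime -/

namespace IsPrimitiveRootMod

variable {K Γ : Type*} [Field K] [LinearOrderedCommGroupWithZero Γ] {v : Valuation K Γ}
  {q : K} {L : ℕ}

/-- From X ≈ TS, Y ≈ T'S, T ≈ P, T' ≈ P' follows X ≈ (P/P')Y. Only P' is inverted: the common factor
S need not be a unit. -/
theorem _root_.Valuation.sub_mul_le_of_mulClose {δ : Γ} (hδ : δ < 1) {X T P S Y T' P' E : K}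
    (hX : v (X - T * S) ≤ δ) (hT : v (T - P) ≤ δ) (hS : v S ≤ 1) (hY : v (Y - T' * S) ≤ δ)
    (hT' : v (T' - P') ≤ δ) (hP : v P = 1) (hP' : v P' = 1) (hE : MulClose v δ E (P / P')) :
    v (X - E * Y) ≤ δ := by
  have hvE : v E = 1 := by rw [hE.val_eq hδ, map_div₀, hP, hP', div_one]
  have hP'0 : P' ≠ 0 := by rintro rfl; simp at hP'
  have hEP : v (E - P / P') ≤ δ :=
    hE.sub_le (hE.right_ne_zero hδ) (by rw [map_div₀, hP, hP', div_one])
  have mul_le : ∀ {a b : K}, v a ≤ δ → v b ≤ 1 → v (a * b) ≤ δ := by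
    intro a b ha hb
    rw [map_mul]
    exact (mul_le_mul' ha hb).trans (mul_one δ).le
  have e : X - E * Y = (X - T * S) + (T - P) * S - (E - P / P') * (P' * S) -
      (T' - P') * (S * E) - (Y - T' * S) * E := by
    field_simp
    ring
  rw [e]
  have hP'S : v (P' * S) ≤ 1 := by rw [map_mul, hP', one_mul]; exact hS
  have hSE : v (S * E) ≤ 1 := by rw [map_mul, hvE, mul_one]; exact hS
  exact v.map_sub_le (v.map_sub_le (v.map_sub_le (v.map_add_le hX (mul_le hT hS))
    (mul_le hEP hP'S)) (mul_le hT' hSE)) (mul_le hY hvE.le)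

theorem le_of_sq {δ a : Γ} (hδ : δ < 1) (h : a ≤ δ ^ 2) : a ≤ δ :=
  h.trans (by simpa using pow_le_pow_right_of_le_one' hδ.le one_le_two)

/-- The Dwork-type congruence modulo a prime belonging to a proper divisor of `n * (L * m)`. -/
theorem dwork_congr {n : ℕ} (H : IsPrimitiveRootMod v q (L * n)) {m d : ℕ} (hL : L % 4 = 1)
    (hn : n % 4 = 1) (hm : m % 2 = 1) (hd : d = 1 ∨ d = 2) :
    v (∑ k ∈ Finset.range ((L * n * m - 1) / d + 1), dworkTerm q k -
      dworkProd q (L * n * m) / dworkProd (q ^ n) (L * m) *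
        ∑ k ∈ Finset.range ((L * m - 1) / d + 1), dworkTerm (q ^ n) k) ≤ v (1 - q ^ (L * n)) := by
  have H' : IsPrimitiveRootMod v (q ^ n) L := H.pow_root (by omega)
  have hLn : L * n % 4 = 1 := by rw [Nat.mul_mod, hL, hn]
  have eL : (q ^ n) ^ L = q ^ (L * n) := by rw [← pow_mul, mul_comm]
  have hX := H.sum_dworkTerm_sub_le hLn hm hd
  have hY := H'.sum_dworkTerm_sub_le hL hm hd
  obtain ⟨hT, hP⟩ := H.dworkSum_sub_dworkProd_le hLn
  obtain ⟨hT', hP'⟩ := H'.dworkSum_sub_dworkProd_le hL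
  have hE := H.mulClose_dworkProd_mul hLn hm
  have hE' := H'.mulClose_dworkProd_mul hL hm
  -- Now both sums carry the same factor S, a truncated sum in q^(Ln).
  rw [eL] at hY hT' hE'
  refine Valuation.sub_mul_le_of_mulClose H.val_lt hX (le_of_sq H.val_lt hT) ?_ hY
    (le_of_sq H.val_lt hT') hP hP' ?_
  · exact v.map_sum_le fun i _ => (H.val_dworkTerm_pow_root (by rintro h; omega) i).le
  · have h := hE.div H.val_lt hE'
    have h0 := left_ne_zero_of_mul (hE.right_ne_zero H.val_lt)
    rwa [mul_div_mul_left _ _ h0] at h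

/-- The Dwork-type congruence modulo the square of the prime belonging to `L * n`. -/
theorem dwork_congr_sq {n : ℕ} (H : IsPrimitiveRootMod v q (L * n)) {d : ℕ} (hL : L % 4 = 1)
    (hn : n % 4 = 1) (hd : d = 1 ∨ d = 2) :
    v (∑ k ∈ Finset.range ((L * n - 1) / d + 1), dworkTerm q k -
      dworkProd q (L * n) / dworkProd (q ^ n) L *
        ∑ k ∈ Finset.range ((L - 1) / d + 1), dworkTerm (q ^ n) k) ≤ v (1 - q ^ (L * n)) ^ 2 := by
  have H' : IsPrimitiveRootMod v (q ^ n) L := H.pow_root (by omega)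
  have hLn : L * n % 4 = 1 := by rw [Nat.mul_mod, hL, hn]
  have eL : (q ^ n) ^ L = q ^ (L * n) := by rw [← pow_mul, mul_comm]
  have hX := H.sum_dworkTerm_sub_le_sq hLn hd
  have hY := H'.sum_dworkTerm_sub_le_sq hL hd
  obtain ⟨hT, hP⟩ := H.dworkSum_sub_dworkProd_le hLn
  obtain ⟨hT', hP'⟩ := H'.dworkSum_sub_dworkProd_le hL
  rw [eL] at hY hT'
  -- With a single block, S = 1.
  rw [← mul_one (dworkSum _ _)] at hX hY
  refine Valuation.sub_mul_le_of_mulClose H.sq_val_lt hX hT (map_one v).le hY hT' hP hP'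
    (MulClose.refl fun h => ?_)
  simpa [map_div₀, hP, hP'] using congrArg v h

end IsPrimitiveRootMod

/-! ### The valuation of a prime in a factorial ring -/

section PrimeValuation

variable {R K : Type*} [CommRing R] [IsDomain R] [UniqueFactorizationMonoid R] [Field K]
  [Algebra R K] [IsFractionRing R K]

/-- The fractions whose denominator is not divisible by the prime `p`. -/
def Prime.valuationSubring (K : Type*) [Field K] [Algebra R K] [IsFractionRing R K] {p : R}
    (hp : Prime p) : ValuationSubring K where
  carrier := {x | ∃ f g : R, ¬ p ∣ g ∧ x * algebraMap R K g = algebraMap R K f}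
  mul_mem' := by
    rintro x y ⟨f, g, hg, h⟩ ⟨f', g', hg', h'⟩
    refine ⟨f * f', g * g', hp.not_dvd_mul hg hg', ?_⟩
    rw [map_mul, map_mul, ← h, ← h']; ring
  one_mem' := ⟨1, 1, hp.not_dvd_one, by simp⟩
  add_mem' := by
    rintro x y ⟨f, g, hg, h⟩ ⟨f', g', hg', h'⟩
    refine ⟨f * g' + f' * g, g * g', hp.not_dvd_mul hg hg', ?_⟩
    rw [map_mul, map_add, map_mul, map_mul, ← h, ← h']; ring
  zero_mem' := ⟨0, 1, hp.not_dvd_one, by simp⟩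
  neg_mem' := by
    rintro x ⟨f, g, hg, h⟩
    exact ⟨-f, g, hg, by rw [map_neg, ← h]; ring⟩
  mem_or_inv_mem' := by
    intro x
    have hd : algebraMap R K (IsFractionRing.den R x) ≠ 0 :=
      IsFractionRing.to_map_ne_zero_of_mem_nonZeroDivisors (IsFractionRing.den R x).2
    have hx' : x * algebraMap R K (IsFractionRing.den R x) =
        algebraMap R K (IsFractionRing.num R x) := by
      simpa only [IsFractionRing.mk'_num_den] using
        IsLocalization.mk'_spec K (IsFractionRing.num R x) (IsFractionRing.den R x)
    -- In a reduced fraction p cannot divide both numerator and denominator.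
    by_cases h : p ∣ (IsFractionRing.den R x : R)
    · right
      refine ⟨IsFractionRing.den R x, IsFractionRing.num R x, fun h' => hp.not_isUnit
        (IsFractionRing.num_den_reduced R x h' h), ?_⟩
      have hx0 : x ≠ 0 := by
        rintro rfl
        exact hp.not_isUnit (IsFractionRing.num_den_reduced R (0 : K) (by simp) h)
      rw [← hx']
      field_simp
    · exact Or.inl ⟨_, _, h, hx'⟩

variable {p : R} (hp : Prime p)

theorem Prime.val_algebraMap_eq_one {g : R} (hg : ¬ p ∣ g) :
    (hp.valuationSubring K).valuation (algebraMap R K g) = 1 := by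
  have hg0 : algebraMap R K g ≠ 0 := by
    rw [Ne, FaithfulSMul.algebraMap_eq_zero_iff]
    rintro rfl
    exact hg (dvd_zero p)
  refine le_antisymm ?_ ?_
  · rw [ValuationSubring.valuation_le_one_iff]
    exact ⟨g, 1, hp.not_dvd_one, by simp⟩
  · have h : (hp.valuationSubring K).valuation (algebraMap R K g)⁻¹ ≤ 1 := by
      rw [ValuationSubring.valuation_le_one_iff]
      exact ⟨1, g, hg, by simp [hg0]⟩
    rw [map_inv₀] at h
    exact (inv_le_one₀ (zero_lt_iff.mpr ((Valuation.ne_zero_iff _).mpr hg0))).mp h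

theorem Prime.val_algebraMap_le_one (g : R) :
    (hp.valuationSubring K).valuation (algebraMap R K g) ≤ 1 := by
  rw [ValuationSubring.valuation_le_one_iff]
  exact ⟨g, 1, hp.not_dvd_one, by simp⟩

theorem Prime.val_self_lt_one : (hp.valuationSubring K).valuation (algebraMap R K p) < 1 := by
  have hp0 : algebraMap R K p ≠ 0 := by
    rw [Ne, FaithfulSMul.algebraMap_eq_zero_iff]; exact hp.ne_zero
  by_contra! h
  have h2 : (hp.valuationSubring K).valuation (algebraMap R K p)⁻¹ ≤ 1 := by
    rw [map_inv₀]; exact inv_le_one_of_one_le₀ h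
  rw [ValuationSubring.valuation_le_one_iff] at h2
  obtain ⟨f, g, hg, e⟩ := h2
  refine hg ⟨f, FaithfulSMul.algebraMap_injective R K ?_⟩
  rw [map_mul, ← e]
  field_simp

/-- The bound makes x / p^e integral at p, so x g = p^e f with p ∤ g; clearing the denominator of x
and cancelling g leaves p^e in the numerator. -/
theorem Prime.pow_dvd_num_of_val_le {x : K} {e : ℕ}
    (h : (hp.valuationSubring K).valuation x ≤
      (hp.valuationSubring K).valuation (algebraMap R K p) ^ e) :
    p ^ e ∣ IsFractionRing.num R x := by
  have hp0 : algebraMap R K p ≠ 0 := by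
    rw [Ne, FaithfulSMul.algebraMap_eq_zero_iff]; exact hp.ne_zero
  have h2 : (hp.valuationSubring K).valuation (x / algebraMap R K p ^ e) ≤ 1 := by
    rw [map_div₀, map_pow]
    exact div_le_one_of_le₀ h zero_le
  rw [ValuationSubring.valuation_le_one_iff] at h2
  obtain ⟨f, g, hg, he⟩ := h2
  have hd : algebraMap R K (IsFractionRing.den R x) ≠ 0 :=
    IsFractionRing.to_map_ne_zero_of_mem_nonZeroDivisors (IsFractionRing.den R x).2
  have hx : algebraMap R K (IsFractionRing.num R x) =
      x * algebraMap R K (IsFractionRing.den R x) := by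
    simpa only [IsFractionRing.mk'_num_den] using
      (IsLocalization.mk'_spec K (IsFractionRing.num R x) (IsFractionRing.den R x)).symm
  refine hp.pow_dvd_of_dvd_mul_right e hg ⟨f * IsFractionRing.den R x,
    FaithfulSMul.algebraMap_injective R K ?_⟩
  rw [map_mul, map_mul, map_mul, map_pow, hx, ← he]
  field_simp

end PrimeValuation

/-! ### Cyclotomic primes of ℤ[q] -/

section Cyclotomic

theorem cyclotomic_not_dvd_of_aeval_ne_zero {L : ℕ} {ζ : ℂ} (hL : L ≠ 0)
    (hζ : IsPrimitiveRoot ζ L) {g : ℤ[X]} (hg : aeval ζ g ≠ 0) : ¬ cyclotomic L ℤ ∣ g := by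
  rintro ⟨f, rfl⟩
  apply hg
  have h := hζ.isRoot_cyclotomic (Nat.pos_of_ne_zero hL)
  rw [IsRoot.def, ← map_cyclotomic_int, eval_map] at h
  rw [map_mul, aeval_def, Subsingleton.elim (algebraMap ℤ ℂ) (Int.castRingHom ℂ), h, zero_mul]

theorem cyclotomic_prime {L : ℕ} (hL : L ≠ 0) : Prime (cyclotomic L ℤ) :=
  (cyclotomic.irreducible (Nat.pos_of_ne_zero hL)).prime

theorem algebraMap_X_eq_qvar : algebraMap ℤ[X] (RatFunc ℤ) X = qvar :=
  RatFunc.algebraMap_X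

/-- One inequality suffices: a bound by 1 - q^L is then also a bound by Φ_L. -/
theorem val_one_sub_qvar_pow_le {L : ℕ} (hL : L ≠ 0) :
    ((cyclotomic_prime hL).valuationSubring (RatFunc ℤ)).valuation (1 - qvar ^ L) ≤
      ((cyclotomic_prime hL).valuationSubring (RatFunc ℤ)).valuation
        (algebraMap ℤ[X] (RatFunc ℤ) (cyclotomic L ℤ)) := by
  obtain ⟨f, hf⟩ := cyclotomic.dvd_X_pow_sub_one L ℤ
  have e : 1 - qvar ^ L =
      -(algebraMap ℤ[X] (RatFunc ℤ) (cyclotomic L ℤ) * algebraMap ℤ[X] (RatFunc ℤ) f) := by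
    rw [← map_mul, ← hf, map_sub, map_pow, algebraMap_X_eq_qvar, map_one, neg_sub]
  rw [e, Valuation.map_neg, map_mul]
  exact mul_le_of_le_one_right' ((cyclotomic_prime hL).val_algebraMap_le_one f)

theorem qvar_pow_ne_one {i : ℕ} (hi : i ≠ 0) : qvar ^ i ≠ 1 := by
  rw [← algebraMap_X_eq_qvar, ← map_pow, ← map_one (algebraMap ℤ[X] (RatFunc ℤ))]
  intro h
  have := congrArg natDegree (FaithfulSMul.algebraMap_injective ℤ[X] (RatFunc ℤ) h)
  simp [hi] at this

theorem isPrimitiveRootMod_qvar {L : ℕ} (hL : L ≠ 0) :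
    IsPrimitiveRootMod ((cyclotomic_prime hL).valuationSubring (RatFunc ℤ)).valuation qvar L := by
  have hζ := Complex.isPrimitiveRoot_exp L hL
  set ζ := Complex.exp (2 * Real.pi * Complex.I / L)
  refine ⟨?_, ?_, fun i hi => ?_, fun i hi => qvar_pow_ne_one hi, fun m hm => ?_⟩
  · rw [← algebraMap_X_eq_qvar]
    refine (cyclotomic_prime hL).val_algebraMap_eq_one
      (cyclotomic_not_dvd_of_aeval_ne_zero hL hζ ?_)
    rw [aeval_X]
    exact hζ.ne_zero hL
  · exact (val_one_sub_qvar_pow_le hL).trans_lt (cyclotomic_prime hL).val_self_lt_one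
  · have e : 1 - qvar ^ i = algebraMap ℤ[X] (RatFunc ℤ) (1 - X ^ i) := by
      rw [map_sub, map_pow, algebraMap_X_eq_qvar, map_one]
    rw [e]
    refine (cyclotomic_prime hL).val_algebraMap_eq_one
      (cyclotomic_not_dvd_of_aeval_ne_zero hL hζ ?_)
    rw [map_sub, map_one, map_pow, aeval_X, sub_ne_zero]
    exact fun h => hi (hζ.dvd_of_pow_eq_one i h.symm)
  · rw [← map_natCast (algebraMap ℤ[X] (RatFunc ℤ))]
    refine (cyclotomic_prime hL).val_algebraMap_eq_one
      (cyclotomic_not_dvd_of_aeval_ne_zero hL hζ ?_)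
    rw [map_natCast]
    exact_mod_cast hm

/-- The modulus is a product of powers of pairwise non-associated primes. -/
theorem cyclotomic_mul_prod_dvd {n r : ℕ} (hn : 1 < n) (hr : 1 ≤ r) {z : ℤ[X]}
    (hz : ∀ j ∈ Finset.Icc 1 r, cyclotomic (n ^ j) ℤ ^ (if j = r then 2 else 1) ∣ z) :
    cyclotomic (n ^ r) ℤ * ∏ j ∈ Finset.Icc 1 r, cyclotomic (n ^ j) ℤ ∣ z := by
  have e : cyclotomic (n ^ r) ℤ * ∏ j ∈ Finset.Icc 1 r, cyclotomic (n ^ j) ℤ =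
      ∏ j ∈ Finset.Icc 1 r, cyclotomic (n ^ j) ℤ ^ (if j = r then 2 else 1) := by
    have e1 : ∀ j, cyclotomic (n ^ j) ℤ ^ (if j = r then 2 else 1) =
        (if j = r then cyclotomic (n ^ j) ℤ else 1) * cyclotomic (n ^ j) ℤ := by
      intro j
      split_ifs <;> ring
    simp only [e1, Finset.prod_mul_distrib, Finset.prod_ite_eq', Finset.mem_Icc, hr, le_refl,
      and_self, if_true]
  rw [e]
  refine Finset.prod_dvd_of_isRelPrime (fun i _ j _ hij => IsRelPrime.pow ?_) hz
  have hi : Irreducible (cyclotomic (n ^ i) ℤ) := cyclotomic.irreducible (by positivity)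
  have hj : Irreducible (cyclotomic (n ^ j) ℤ) := cyclotomic.irreducible (by positivity)
  rw [hi.isRelPrime_iff_not_dvd]
  intro h
  have h2 := eq_of_monic_of_associated (cyclotomic.monic _ ℤ) (cyclotomic.monic _ ℤ)
    (hi.associated_of_dvd hj h)
  exact hij (Nat.pow_right_injective hn (cyclotomic_injective h2))

end Cyclotomic

/-! ### Assembly of the theorem -/

theorem qPochhammer_succ_left {K : Type*} [Field K] (a q : K) (n : ℕ) :
    qPochhammer a q (n + 1) = (1 - a) * qPochhammer (a * q) q n := by
  rw [qPochhammer, qPochhammer, Finset.prod_range_succ', mul_comm]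
  congr 1
  · simp
  · exact Finset.prod_congr rfl fun i _ => by ring

/-- Splitting off the first factor 1 - q of (q; q⁴)_{(L+1)/2} gives the shape used in the theorem.
-/
theorem dworkProd_eq_qInteger {K : Type*} [Field K] (q : K) {L : ℕ} (hL : L % 2 = 1) :
    dworkProd q L = qInteger L q *
      (qPochhammer (q ^ 3) (q ^ 4) ((L - 1) / 2) / qPochhammer (q ^ 5) (q ^ 4) ((L - 1) / 2)) := by
  rw [dworkProd, qInteger, show (L + 1) / 2 = (L - 1) / 2 + 1 by omega, qPochhammer_succ_left,
    show q * q ^ 4 = q ^ 5 by ring, div_mul_div_comm]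

theorem theorem1p1 (n r d : ℕ) (hn : n % 4 = 1) (hr : 1 ≤ r) (hd : d = 1 ∨ d = 2) :
    RatFuncCongr
      (cyclotomic (n ^ r) ℤ * ∏ j ∈ Finset.Icc 1 r, cyclotomic (n ^ j) ℤ)
      (∑ k ∈ Finset.range ((n ^ r - 1) / d + 1),
        qPochhammer qvar (qvar ^ 2) k ^ 2 * qPochhammer (qvar ^ 2) (qvar ^ 4) k /
          (qPochhammer (qvar ^ 2) (qvar ^ 2) k ^ 2 * qPochhammer (qvar ^ 4) (qvar ^ 4) k) *
          qvar ^ (2 * k))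
      (qInteger n qvar *
        (qPochhammer (qvar ^ 3) (qvar ^ 4) ((n ^ r - 1) / 2) *
            qPochhammer (qvar ^ (5 * n)) (qvar ^ (4 * n)) ((n ^ (r - 1) - 1) / 2) /
          (qPochhammer (qvar ^ 5) (qvar ^ 4) ((n ^ r - 1) / 2) *
            qPochhammer (qvar ^ (3 * n)) (qvar ^ (4 * n)) ((n ^ (r - 1) - 1) / 2))) *
        ∑ k ∈ Finset.range ((n ^ (r - 1) - 1) / d + 1),
          qPochhammer (qvar ^ n) (qvar ^ (2 * n)) k ^ 2 *
              qPochhammer (qvar ^ (2 * n)) (qvar ^ (4 * n)) k /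
            (qPochhammer (qvar ^ (2 * n)) (qvar ^ (2 * n)) k ^ 2 *
              qPochhammer (qvar ^ (4 * n)) (qvar ^ (4 * n)) k) *
            qvar ^ (2 * n * k)) := by
  have hpow : ∀ j, n ^ j % 4 = 1 := fun j => by rw [Nat.pow_mod, hn, one_pow]; norm_num
  have hN : n ^ r = n ^ (r - 1) * n := by rw [← pow_succ, Nat.sub_add_cancel hr]
  have hsum : ∀ k, qPochhammer (qvar ^ n) (qvar ^ (2 * n)) k ^ 2 *
      qPochhammer (qvar ^ (2 * n)) (qvar ^ (4 * n)) k /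
      (qPochhammer (qvar ^ (2 * n)) (qvar ^ (2 * n)) k ^ 2 *
        qPochhammer (qvar ^ (4 * n)) (qvar ^ (4 * n)) k) * qvar ^ (2 * n * k) =
      dworkTerm (qvar ^ n) k := by
    intro k
    rw [dworkTerm, ← pow_mul, ← pow_mul, ← pow_mul, mul_comm n 2, mul_comm n 4]
    congr 2
    ring
  have hsum' : ∀ k, qPochhammer qvar (qvar ^ 2) k ^ 2 * qPochhammer (qvar ^ 2) (qvar ^ 4) k /
      (qPochhammer (qvar ^ 2) (qvar ^ 2) k ^ 2 * qPochhammer (qvar ^ 4) (qvar ^ 4) k) *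
      qvar ^ (2 * k) = dworkTerm qvar k := fun _ => rfl
  -- The q-integers combine as [n^r]_q / [n^(r-1)]_{q^n} = [n]_q.
  have hprod : qInteger n qvar *
      (qPochhammer (qvar ^ 3) (qvar ^ 4) ((n ^ r - 1) / 2) *
          qPochhammer (qvar ^ (5 * n)) (qvar ^ (4 * n)) ((n ^ (r - 1) - 1) / 2) /
        (qPochhammer (qvar ^ 5) (qvar ^ 4) ((n ^ r - 1) / 2) *
          qPochhammer (qvar ^ (3 * n)) (qvar ^ (4 * n)) ((n ^ (r - 1) - 1) / 2))) =
      dworkProd qvar (n ^ r) / dworkProd (qvar ^ n) (n ^ (r - 1)) := by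
    have h1 : 1 - qvar ^ n ≠ 0 := sub_ne_zero.mpr (qvar_pow_ne_one (by omega)).symm
    have h2 : 1 - qvar ^ n ^ r ≠ 0 :=
      sub_ne_zero.mpr (qvar_pow_ne_one (by have := hpow r; omega)).symm
    rw [dworkProd_eq_qInteger _ (by have := hpow r; omega),
      dworkProd_eq_qInteger _ (by have := hpow (r - 1); omega), qInteger, qInteger, qInteger]
    have e : (qvar ^ n) ^ n ^ (r - 1) = qvar ^ n ^ r := by rw [← pow_mul, hN, mul_comm n]
    rw [e, ← pow_mul, ← pow_mul, ← pow_mul, mul_comm n 3, mul_comm n 4, mul_comm n 5]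
    field_simp
  simp only [hsum, hsum']
  rw [hprod]
  -- For n = 1 the primes Φ_{n^j} all coincide, but the two sides are then equal.
  rcases (show n = 1 ∨ 1 < n by omega) with rfl | hn1
  · have h1 : dworkProd qvar 1 ≠ 0 := by
      have h0 : 1 - qvar ≠ 0 := by
        simpa using sub_ne_zero.mpr (qvar_pow_ne_one one_ne_zero).symm
      simp [dworkProd, qPochhammer, h0]
    simp [RatFuncCongr, h1]
  refine cyclotomic_mul_prod_dvd hn1 hr fun j hj => ?_
  rw [Finset.mem_Icc] at hj
  have hjn : n ^ j = n ^ (j - 1) * n := by rw [← pow_succ, Nat.sub_add_cancel hj.1]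
  have hj0 : n ^ (j - 1) * n ≠ 0 := by positivity
  rw [hjn]
  refine (cyclotomic_prime hj0).pow_dvd_num_of_val_le ?_
  refine le_trans ?_ (pow_le_pow_left' (val_one_sub_qvar_pow_le hj0) _)
  have H := isPrimitiveRootMod_qvar hj0
  generalize ((cyclotomic_prime hj0).valuationSubring (RatFunc ℤ)).valuation = v at H ⊢
  split_ifs with hjr
  · subst hjr
    rw [hN]
    exact H.dwork_congr_sq (hpow _) hn hd
  · have e1 : n ^ r = n ^ (j - 1) * n * n ^ (r - j) := by
      rw [← hjn, ← pow_add, Nat.add_sub_cancel' hj.2]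
    have e2 : n ^ (r - 1) = n ^ (j - 1) * n ^ (r - j) := by
      rw [← pow_add]; congr 1; omega
    rw [pow_one, e1, e2]
    exact H.dwork_congr (hpow _) hn (by have := hpow (r - j); omega) hd
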